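/- **Theorem (Sparse case).** A multigraph on a vertex set $V$ is a function $w$ assigning to each pair $xy$ of distinct vertices a multiplicity $w(xy)\in\mathbb Z_{\ge 0}$. For integers $s\ge 2$ and $q\ge 0$, an $(s,q)$-graph is a multigraph in which every set $X$ of $s$ vertices satisfies $\sum_{xy\in\binom{X}{2}} w(xy)\le q$. For $n\ge s$ let $\mathrm{ex}_\Pi(n,s,q)$ be the maximum of $\prod_{xy\in\binom{[n]}{2}} w(xy)$ over all $(s,q)$-graphs on $[n]=\{1,\dots,n\}$. Let $\mathrm{ex}(n,\{C_3,\dots,C_s\})$ be the maximum number of edges of a simple graph on $n$ vertices that contains no cycle of length between $3$ and $s$. Let $s\ge 2$ and $0\le q\le 2\binom s2$ be integers. Then, for all $n\ge s$, $$ \mathrm{ex}_\Pi(n,s,q)=\begin{cases} 0 & \text{if } 0\le q<\binom s2,\\ 1 & \text{if } q=\binom s2,\\ 2^{\,q-\binom s2} & \text{if } \binom s2<q<\binom s2+\lfloor \frac s2\rfloor,\\ 2^{\Theta(n)} & \text{if } \binom s2+\lfloor \frac s2\rfloor\le q<\binom s2+s-2,\\ 2^{\left\lfloor \frac{s-2}{s-1}\,n\right\rfloor}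 & \text{if } q=\binom s2+s-2,\\ 2^{\mathrm{ex}(n,\{C_3,C_4,\dots,C_s\})} & \text{if } q=\binom s2+s-1,\\ 2^{o(n^2)} & \text{if } \binom s2+s\le q<\binom s2+\lfloor \frac{s^2}{4}\rfloor,\\ 2^{\Theta(n^2)} & \text{if } \binom s2+\lfloor \frac{s^2}{4}\rfloor\le q\le 2\binom s2, \end{cases} $$ where the asymptotic notation is for $n\to\infty$ with $s$ and $q$ fixed. -/

import Mathlib

open Filter Asymptotics

namespace ProductTuran

/-- A multigraph on `V`: a non-negative integer multiplicity for every pair of distinct vertices.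
Pairs are elements of `Sym2 V`; the diagonal ones are not edges, and their weight is fixed to `0`. -/
structure Multigraph (V : Type*) where
  w : Sym2 V → ℕ
  w_of_isDiag : ∀ e : Sym2 V, e.IsDiag → w e = 0

/-- The set of all pairs of distinct elements of `X`. -/
def pairs {V : Type*} [DecidableEq V] (X : Finset V) : Finset (Sym2 V) :=
  X.sym2.filter fun e => ¬ e.IsDiag

namespace Multigraph

variable {V : Type*} [DecidableEq V]

/-- The sum of the edge multiplicities inside `X`. -/
def edgeSum (G : Multigraph V) (X : Finset V) : ℕ :=
  ∑ e ∈ pairs X, G.w e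

/-- The product of all the edge multiplicities of `G`. -/
def edgeProd [Fintype V] (G : Multigraph V) : ℕ :=
  ∏ e ∈ pairs (Finset.univ : Finset V), G.w e

/-- `G` is an `(s, q)`-graph: every `s`-set of vertices spans at most `q` edges,
counted with multiplicity. -/
def IsSQGraph (G : Multigraph V) (s q : ℕ) : Prop :=
  ∀ X : Finset V, X.card = s → G.edgeSum X ≤ q

end Multigraph

/-- The maximum of the product of the edge multiplicities over all `(s, q)`-graphs on `n` labelled
vertices. For `2 ≤ s ≤ n` this supremum is an attained maximum, see `exPi_isGreatest`. -/
noncomputable def exPi (n s q : ℕ) : ℕ :=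
  sSup {p : ℕ | ∃ G : Multigraph (Fin n), G.IsSQGraph s q ∧ G.edgeProd = p}

/-- The maximum number of edges of a graph on `n` vertices that contains none of the cycles
`C₃, C₄, …, Cₛ` as a subgraph. -/
noncomputable def exCycles (n s : ℕ) : ℕ :=
  sSup {m : ℕ | ∃ G : SimpleGraph (Fin n),
    (∀ k : ℕ, 3 ≤ k → k ≤ s → (SimpleGraph.cycleGraph k).Free G) ∧ G.edgeSet.ncard = m}

/-- The maximum in the definition of `exPi` exists as soon as `2 ≤ s ≤ n`. -/
theorem exPi_isGreatest {n s : ℕ} (q : ℕ) (hs : 2 ≤ s) (hn : s ≤ n) :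
    IsGreatest {p : ℕ | ∃ G : Multigraph (Fin n), G.IsSQGraph s q ∧ G.edgeProd = p}
      (exPi n s q) := by
  have hne : {p : ℕ | ∃ G : Multigraph (Fin n), G.IsSQGraph s q ∧ G.edgeProd = p}.Nonempty :=
    ⟨_, ⟨fun _ => 0, fun _ _ => rfl⟩, fun X _ => by simp [Multigraph.edgeSum], rfl⟩
  have hbd : BddAbove {p : ℕ | ∃ G : Multigraph (Fin n), G.IsSQGraph s q ∧ G.edgeProd = p} := by
    refine ⟨∏ _e ∈ pairs (Finset.univ : Finset (Fin n)), q, ?_⟩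
    rintro p ⟨G, hG, rfl⟩
    refine Finset.prod_le_prod' fun e he => ?_
    induction e using Sym2.ind with
    | _ a b =>
      obtain ⟨X, hX, hc⟩ := Finset.exists_superset_card_eq
        (s := ({a, b} : Finset (Fin n))) (n := s)
        (le_trans Finset.card_le_two hs) (by simpa using hn)
      refine le_trans ?_ (hG X hc)
      refine Finset.single_le_sum (f := G.w) (fun _ _ => Nat.zero_le _) ?_
      simp only [pairs, Finset.mem_filter, Finset.mk_mem_sym2_iff] at he ⊢
      exact ⟨⟨hX (by simp), hX (by simp)⟩, he.2⟩
  exact ⟨Nat.sSup_mem hne hbd, fun p hp => le_csSup hbd hp⟩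

/-- The maximum in the definition of `exCycles` always exists. -/
theorem exCycles_isGreatest (n s : ℕ) :
    IsGreatest {m : ℕ | ∃ G : SimpleGraph (Fin n),
      (∀ k : ℕ, 3 ≤ k → k ≤ s → (SimpleGraph.cycleGraph k).Free G) ∧ G.edgeSet.ncard = m}
      (exCycles n s) := by
  have hne : {m : ℕ | ∃ G : SimpleGraph (Fin n),
      (∀ k : ℕ, 3 ≤ k → k ≤ s → (SimpleGraph.cycleGraph k).Free G) ∧
        G.edgeSet.ncard = m}.Nonempty := by
    refine ⟨_, ⊥, fun k hk _ => ?_, rfl⟩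
    rintro ⟨f⟩
    obtain ⟨m, rfl⟩ : ∃ m, k = m + 2 := ⟨k - 2, by omega⟩
    have h : (SimpleGraph.cycleGraph (m + 2)).Adj 0 1 := by
      simp [SimpleGraph.cycleGraph_adj]
    exact (f.toHom.map_adj h).elim
  have hbd : BddAbove {m : ℕ | ∃ G : SimpleGraph (Fin n),
      (∀ k : ℕ, 3 ≤ k → k ≤ s → (SimpleGraph.cycleGraph k).Free G) ∧ G.edgeSet.ncard = m} := by
    refine ⟨(Set.univ : Set (Sym2 (Fin n))).ncard, ?_⟩
    rintro m ⟨G, -, rfl⟩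
    exact Set.ncard_le_ncard (Set.subset_univ _) Set.finite_univ
  exact ⟨Nat.sSup_mem hne hbd, fun p hp => le_csSup hbd hp⟩

end ProductTuran

/-! Write q = C(s,2) + t. If t < 0, every multigraph has a pair of multiplicity 0. Otherwise the
optimum is positive, so an optimal multigraph has the form w = 1 + x. Since 1 + x ≤ 2^x, with
equality for x in {0, 1}, the product is at most 2^e(x), where e(x) is the total of x. The problem
becomes additive: maximise e(x) when each s-set spans at most t. Upper bounds hold for all integer
weights x, and the constructions are 0/1-valued (`exists_esum_of_exPi_ne_zero`,
`two_pow_esum_le_exPi`).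

For t < ⌊s/2⌋, any t + 1 edges fit into one s-set, so e(x) ≤ t. From ⌊s/2⌋ on, a perfect or
near-perfect matching is allowed, so growth is at least linear.

For t = s - 2, small sparse pieces with no edges to the rest can be split off repeatedly
(`mul_esum_le`); disjoint stars on s - 1 vertices are optimal. This also bounds every smaller t.

For t = s - 1, the model is a graph in which every set of at most s vertices spans a forest, that
is, one without short cycles. Low degree vertices and small dense components are removed by
induction until x has this form (`esum_le_of_locallyForest_bound`).

For t < ⌊s²/4⌋, no s-set contains a balanced complete bipartite graph, and a weighted
Kővári–Sós–Turán count gives o(n²). From ⌊s²/4⌋ on, the balanced complete bipartite graph on all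
vertices is allowed, while each weight is at most t. -/

namespace ProductTuran

/-! ### Weighted edge counts, closed sets and dense sets -/

section EdgeSums

variable {V W : Type*} [DecidableEq V] [DecidableEq W]

/-- The sum of `x` over all pairs of distinct elements of `X`. -/
def esum (x : Sym2 V → ℕ) (X : Finset V) : ℕ :=
  ∑ e ∈ pairs X, x e

theorem mk_mem_pairs {X : Finset V} {a b : V} : s(a, b) ∈ pairs X ↔ a ∈ X ∧ b ∈ X ∧ a ≠ b := by
  simp [pairs, and_assoc]

theorem pairs_mono {X Y : Finset V} (h : X ⊆ Y) : pairs X ⊆ pairs Y :=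
  Finset.filter_subset_filter _ (Finset.sym2_mono h)

theorem esum_mono (x : Sym2 V → ℕ) {X Y : Finset V} (h : X ⊆ Y) : esum x X ≤ esum x Y :=
  Finset.sum_le_sum_of_subset (pairs_mono h)

theorem pairs_insert {v : V} {X : Finset V} (hv : v ∉ X) :
    pairs (insert v X) = pairs X ∪ X.image (fun u => s(v, u)) := by
  ext e
  induction e using Sym2.ind with
  | _ a b =>
    simp only [mk_mem_pairs, Finset.mem_union, Finset.mem_insert, Finset.mem_image, Sym2.eq_iff]
    constructor
    · rintro ⟨rfl | ha, rfl | hb, hab⟩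
      · exact absurd rfl hab
      · exact Or.inr ⟨b, hb, Or.inl ⟨rfl, rfl⟩⟩
      · exact Or.inr ⟨a, ha, Or.inr ⟨rfl, rfl⟩⟩
      · exact Or.inl ⟨ha, hb, hab⟩
    · rintro (⟨ha, hb, hab⟩ | ⟨u, hu, ⟨rfl, rfl⟩ | ⟨rfl, rfl⟩⟩)
      · exact ⟨Or.inr ha, Or.inr hb, hab⟩
      · exact ⟨Or.inl rfl, Or.inr hu, fun h => hv (h ▸ hu)⟩
      · exact ⟨Or.inr hu, Or.inl rfl, fun h => hv (h ▸ hu)⟩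

theorem esum_insert (x : Sym2 V → ℕ) {v : V} {X : Finset V} (hv : v ∉ X) :
    esum x (insert v X) = esum x X + ∑ u ∈ X, x s(v, u) := by
  have hdisj : Disjoint (pairs X) (X.image (fun u => s(v, u))) := by
    rw [Finset.disjoint_left]
    intro e he he'
    obtain ⟨u, -, rfl⟩ := Finset.mem_image.1 he'
    exact hv (mk_mem_pairs.1 he).1
  rw [esum, pairs_insert hv, Finset.sum_union hdisj, Finset.sum_image]
  · rfl
  · intro a _ b _ h
    exact Sym2.congr_right.1 h

@[simp]
theorem esum_empty (x : Sym2 V → ℕ) : esum x ∅ = 0 := by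
  simp [esum, pairs]

@[simp]
theorem esum_singleton (x : Sym2 V → ℕ) (v : V) : esum x {v} = 0 := by
  have := esum_insert x (Finset.notMem_empty v)
  simpa using this

theorem esum_union (x : Sym2 V → ℕ) {X Y : Finset V} (h : Disjoint X Y) :
    esum x (X ∪ Y) = esum x X + esum x Y + ∑ a ∈ X, ∑ b ∈ Y, x s(a, b) := by
  induction Y using Finset.induction_on with
  | empty => simp
  | insert v Y hv ih =>
    rw [Finset.disjoint_insert_right] at h
    have hv' : v ∉ X ∪ Y := by simp [h.1, hv]
    rw [Finset.union_insert, esum_insert x hv', ih h.2, esum_insert x hv,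
      Finset.sum_union h.2]
    simp only [Finset.sum_insert hv, Finset.sum_add_distrib]
    have : ∑ u ∈ X, x s(v, u) = ∑ u ∈ X, x s(u, v) :=
      Finset.sum_congr rfl fun u _ => by rw [Sym2.eq_swap]
    omega

theorem esum_erase (x : Sym2 V → ℕ) {v : V} {S : Finset V} (hv : v ∈ S) :
    esum x S = esum x (S.erase v) + ∑ u ∈ S.erase v, x s(v, u) := by
  conv_lhs => rw [← Finset.insert_erase hv]
  exact esum_insert x (Finset.notMem_erase v S)

/-- The handshake lemma. -/
theorem sum_sum_erase (x : Sym2 V → ℕ) (S : Finset V) :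
    ∑ v ∈ S, ∑ u ∈ S.erase v, x s(v, u) = 2 * esum x S := by
  induction S using Finset.induction_on with
  | empty => simp
  | insert v S hv ih =>
    rw [Finset.sum_insert hv, Finset.erase_insert hv, esum_insert x hv, mul_add, ← ih]
    have : ∀ a ∈ S, ∑ u ∈ (insert v S).erase a, x s(a, u) =
        x s(v, a) + ∑ u ∈ S.erase a, x s(a, u) := by
      intro a ha
      have hva : v ≠ a := fun h => hv (h ▸ ha)
      rw [Finset.erase_insert_of_ne hva,
        Finset.sum_insert (fun h => hv (Finset.mem_of_mem_erase h)), Sym2.eq_swap]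
    rw [Finset.sum_congr rfl this, Finset.sum_add_distrib]
    omega

theorem pairs_map (φ : W ↪ V) (X : Finset W) :
    pairs (X.map φ) = (pairs X).map φ.sym2Map := by
  ext e
  simp only [pairs, Finset.sym2_map, Finset.mem_filter, Finset.mem_map]
  constructor
  · rintro ⟨⟨e, he, rfl⟩, h⟩
    refine ⟨e, ⟨he, fun hd => h ?_⟩, rfl⟩
    exact (Sym2.isDiag_map φ.injective).2 hd
  · rintro ⟨e, ⟨he, h⟩, rfl⟩
    exact ⟨⟨e, he, rfl⟩, fun hd => h ((Sym2.isDiag_map φ.injective).1 hd)⟩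

theorem esum_map (x : Sym2 V → ℕ) (φ : W ↪ V) (X : Finset W) :
    esum x (X.map φ) = esum (fun e => x (e.map φ)) X := by
  rw [esum, pairs_map, Finset.sum_map]
  rfl

theorem card_pairs (X : Finset V) : (pairs X).card = X.card.choose 2 := by
  have h : ∀ S : Finset V, esum (fun _ : Sym2 V => 1) S = S.card.choose 2 := by
    intro S
    induction S using Finset.induction_on with
    | empty => simp
    | insert v S hv ih =>
      rw [esum_insert _ hv, ih, Finset.card_insert_of_notMem hv, Nat.choose_succ_succ]
      simp [add_comm]
  rw [← h X]
  simp [esum]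

/-- `X` is joined by no edges to the rest of `S`. -/
def ClosedIn (x : Sym2 V → ℕ) (S X : Finset V) : Prop :=
  ∀ a ∈ X, ∀ b ∈ S \ X, x s(a, b) = 0

theorem ClosedIn.esum_eq {x : Sym2 V → ℕ} {S X : Finset V} (h : ClosedIn x S X) (hX : X ⊆ S) :
    esum x S = esum x X + esum x (S \ X) := by
  conv_lhs => rw [← Finset.union_sdiff_of_subset hX]
  rw [esum_union x Finset.disjoint_sdiff,
    Finset.sum_eq_zero fun a ha => Finset.sum_eq_zero fun b hb => h a ha b hb, add_zero]

theorem ClosedIn.compl {x : Sym2 V → ℕ} {S X : Finset V} (h : ClosedIn x S X) (hX : X ⊆ S) :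
    ClosedIn x S (S \ X) := by
  intro a ha b hb
  rw [Finset.sdiff_sdiff_eq_self hX] at hb
  rw [Sym2.eq_swap]
  exact h b hb a ha

theorem ClosedIn.sum_erase {x : Sym2 V → ℕ} {S X : Finset V} (h : ClosedIn x S X) (hX : X ⊆ S)
    {v : V} (hv : v ∈ X) : ∑ u ∈ X.erase v, x s(v, u) = ∑ u ∈ S.erase v, x s(v, u) := by
  refine Finset.sum_subset (Finset.erase_subset_erase v hX) fun u hu hu' => ?_
  refine h v hv u (Finset.mem_sdiff.2 ⟨Finset.mem_of_mem_erase hu, fun hX' => hu' ?_⟩)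
  exact Finset.mem_erase.2 ⟨(Finset.mem_erase.1 hu).1, hX'⟩

/-- Adding the far end of an edge that leaves `X` costs one vertex and gains at least one edge.
Maximal sets in the extremal arguments below are closed for this reason. -/
theorem exists_esum_insert_of_not_closedIn {x : Sym2 V → ℕ} {S X : Finset V}
    (h : ¬ ClosedIn x S X) : ∃ b ∈ S \ X, esum x X + 1 ≤ esum x (insert b X) := by
  unfold ClosedIn at h
  push Not at h
  obtain ⟨a, ha, b, hb, hab⟩ := h
  refine ⟨b, hb, ?_⟩
  rw [esum_insert x (Finset.mem_sdiff.1 hb).2]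
  have : x s(b, a) ≤ ∑ u ∈ X, x s(b, u) :=
    Finset.single_le_sum (f := fun u => x s(b, u)) (fun _ _ => Nat.zero_le _) ha
  rw [Sym2.eq_swap] at this
  omega

/-- In a set all of whose degrees are at least two there are sets of every size that span at least
as many edges as a tree. -/
theorem exists_card_eq_le_esum {x : Sym2 V → ℕ} {S : Finset V}
    (hdeg : ∀ v ∈ S, 2 ≤ ∑ u ∈ S.erase v, x s(v, u)) {k : ℕ} (hk : 1 ≤ k) (hkS : k ≤ S.card) :
    ∃ X ⊆ S, X.card = k ∧ k ≤ esum x X + 1 := by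
  induction k, hk using Nat.le_induction with
  | base =>
    obtain ⟨v, hv⟩ := Finset.card_pos.1 hkS
    exact ⟨{v}, by simpa using hv, by simp, by simp⟩
  | succ k hk ih =>
    obtain ⟨X, hXS, hc, he⟩ := ih (by omega)
    by_cases hcl : ClosedIn x S X
    -- A closed set keeps all its degrees, so the handshake lemma gives one edge more than a tree.
    -- This surplus pays for adding an arbitrary vertex.
    · have hX : X.card ≤ esum x X := by
        have h1 : ∑ v ∈ X, 2 ≤ ∑ v ∈ X, ∑ u ∈ X.erase v, x s(v, u) :=
          Finset.sum_le_sum fun v hv => by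
            rw [hcl.sum_erase hXS hv]
            exact hdeg v (hXS hv)
        rw [sum_sum_erase] at h1
        simp at h1
        omega
      obtain ⟨b, hb, hbX⟩ := Finset.exists_of_ssubset
        (Finset.ssubset_iff_subset_ne.2 ⟨hXS, fun h => by rw [h] at hc; omega⟩)
      refine ⟨insert b X, Finset.insert_subset hb hXS, ?_, ?_⟩
      · rw [Finset.card_insert_of_notMem hbX, hc]
      · have := esum_mono x (Finset.subset_insert b X)
        omega
    · obtain ⟨b, hb, hbe⟩ := exists_esum_insert_of_not_closedIn hcl
      rw [Finset.mem_sdiff] at hb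
      refine ⟨insert b X, Finset.insert_subset hb.1 hXS, ?_, by omega⟩
      rw [Finset.card_insert_of_notMem hb.2, hc]

/-- A largest set of at most `s` vertices that spans at least as many edges as it has vertices is
closed, unless it has `s` vertices. -/
theorem exists_max_dense (x : Sym2 V → ℕ) (S : Finset V) (s : ℕ) :
    ∃ X ⊆ S, X.card ≤ s ∧ X.card ≤ esum x X ∧ (X.card < s → ClosedIn x S X) ∧
      ∀ Y ⊆ S, Y.card ≤ s → Y.card ≤ esum x Y → Y.card ≤ X.card := by
  let F := S.powerset.filter fun X => X.card ≤ s ∧ X.card ≤ esum x X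
  obtain ⟨X, hX, hmax⟩ := F.exists_max_image Finset.card ⟨∅, by simp [F]⟩
  simp only [F, Finset.mem_filter, Finset.mem_powerset] at hX hmax
  refine ⟨X, hX.1, hX.2.1, hX.2.2, fun hlt => ?_, fun Y h1 h2 h3 => hmax Y ⟨h1, h2, h3⟩⟩
  by_contra hcl
  obtain ⟨b, hb, hbe⟩ := exists_esum_insert_of_not_closedIn hcl
  rw [Finset.mem_sdiff] at hb
  have hc := Finset.card_insert_of_notMem hb.2
  have := hmax (insert b X) ⟨Finset.insert_subset hb.1 hX.1, by omega, by omega⟩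
  omega

end EdgeSums

end ProductTuran

namespace ProductTuran

/-! ### Upper bounds at t < ⌊s/2⌋, t = s - 2 and t = s - 1 -/

section UpperBounds

variable {V : Type*} [DecidableEq V]

/-- Averaging over deleted vertices: induction gives e + 3 ≤ n + deg(v) for each v. Summing yields
(n - 2)e ≤ n(n - 3) < (n - 2)(n - 1), hence e ≤ n - 2. -/
theorem esum_add_two_le {x : Sym2 V → ℕ} {c : ℕ}
    (h : ∀ X : Finset V, X.card = c + 2 → esum x X ≤ c) (S : Finset V) (hS : c + 2 ≤ S.card) :
    esum x S + 2 ≤ S.card := by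
  induction hn : S.card using Nat.strong_induction_on generalizing S with
  | _ n ih =>
    rcases hS.eq_or_lt with heq | hlt
    · have := h S heq.symm
      omega
    · have hdeg : ∀ v ∈ S, esum x S + 3 ≤ n + ∑ u ∈ S.erase v, x s(v, u) := by
        intro v hv
        have hc := Finset.card_erase_of_mem hv
        have := ih (n - 1) (by omega) (S.erase v) (by omega) (by omega)
        rw [esum_erase x hv]
        omega
      have hsum := Finset.sum_le_sum hdeg
      rw [Finset.sum_add_distrib, Finset.sum_add_distrib, sum_sum_erase] at hsum
      simp only [Finset.sum_const, smul_eq_mul, hn] at hsum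
      by_contra hcon
      obtain ⟨m, rfl⟩ : ∃ m, n = m + 2 := ⟨n - 2, by omega⟩
      have : m + 1 ≤ esum x S := by omega
      nlinarith

/-- Take a largest dense X; the hypothesis keeps it below c + 2 vertices, so it is closed. Outside
X, grow a tree-like Y as far as size c + 2 for the union permits. Reaching c + 2 would give c + 1
edges, so Y stops earlier and is closed. If Y were dense, X ∪ Y would contradict the choice of X. -/
theorem exists_sparse_closedIn {x : Sym2 V → ℕ} {c : ℕ}
    (h : ∀ X : Finset V, X.card = c + 2 → esum x X ≤ c) (S : Finset V) (hS : c + 2 ≤ S.card) :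
    ∃ Y ⊆ S, ClosedIn x S Y ∧ Y.card ≤ c + 1 ∧ esum x Y + 1 ≤ Y.card := by
  obtain ⟨X, hXS, hXc, hXe, hXcl, hmax⟩ := exists_max_dense x S (c + 2)
  have hX : X.card < c + 2 := by
    refine lt_of_le_of_ne hXc fun heq => ?_
    have := h X heq
    omega
  have hcl := hXcl hX
  let F := (S \ X).powerset.filter fun Y => Y.Nonempty ∧ X.card + Y.card ≤ c + 2 ∧
    Y.card ≤ esum x Y + 1
  have hcS := Finset.card_sdiff_add_card_eq_card hXS
  have hne : F.Nonempty := by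
    obtain ⟨v, hv⟩ : (S \ X).Nonempty := Finset.card_pos.1 (by omega)
    refine ⟨{v}, ?_⟩
    simp only [F, Finset.mem_filter, Finset.mem_powerset, Finset.singleton_subset_iff]
    exact ⟨hv, Finset.singleton_nonempty v, by simp; omega, by simp⟩
  obtain ⟨Y, hY, hYmax⟩ := F.exists_max_image Finset.card hne
  simp only [F, Finset.mem_filter, Finset.mem_powerset] at hY hYmax
  obtain ⟨hYS, hYne, hYc, hYe⟩ := hY
  have hpos := hYne.card_pos
  have hdisj : Disjoint X Y := Finset.disjoint_of_subset_right hYS Finset.disjoint_sdiff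
  have hU : esum x X + esum x Y ≤ esum x (X ∪ Y) := by
    rw [esum_union x hdisj]
    omega
  have hUc := Finset.card_union_of_disjoint hdisj
  have hYlt : X.card + Y.card < c + 2 := by
    refine lt_of_le_of_ne hYc fun heq => ?_
    have := h (X ∪ Y) (by omega)
    omega
  have hYcl : ClosedIn x (S \ X) Y := by
    by_contra hcon
    obtain ⟨b, hb, hbe⟩ := exists_esum_insert_of_not_closedIn hcon
    rw [Finset.mem_sdiff] at hb
    have hc := Finset.card_insert_of_notMem hb.2
    have := hYmax (insert b Y)
      ⟨Finset.insert_subset hb.1 hYS, Finset.insert_nonempty _ _, by omega, by omega⟩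
    omega
  refine ⟨Y, hYS.trans Finset.sdiff_subset, fun a ha b hb => ?_, by omega, ?_⟩
  · rw [Finset.mem_sdiff] at hb
    by_cases hbX : b ∈ X
    · rw [Sym2.eq_swap]
      exact hcl b hbX a (hYS ha)
    · exact hYcl a ha b (by simp [hb.1, hb.2, hbX])
  · by_contra hcon
    have := hmax (X ∪ Y) (Finset.union_subset hXS (hYS.trans Finset.sdiff_subset)) (by omega)
      (by omega)
    omega

theorem mul_esum_le {x : Sym2 V → ℕ} {c : ℕ}
    (h : ∀ X : Finset V, X.card = c + 2 → esum x X ≤ c) (S : Finset V) (hS : c + 2 ≤ S.card) :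
    (c + 1) * esum x S ≤ c * S.card := by
  induction hn : S.card using Nat.strong_induction_on generalizing S with
  | _ n ih =>
    -- Removing at most c + 1 vertices must leave at least c + 2. Below this threshold n ≤ 2c + 2,
    -- which is exactly when (c + 1)(n - 2) ≤ cn.
    by_cases hlarge : 2 * c + 3 ≤ n
    · obtain ⟨Y, hYS, hcl, hYc, hYe⟩ := exists_sparse_closedIn h S hS
      have hc := Finset.card_sdiff_add_card_eq_card hYS
      have hrec := ih (S \ Y).card (by omega) (S \ Y) (by omega) rfl
      rw [hcl.esum_eq hYS, ← hn, ← hc]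
      have h1 : (c + 1) * esum x Y ≤ c * Y.card := by nlinarith
      linarith
    · have := esum_add_two_le h S hS
      obtain ⟨m, rfl⟩ : ∃ m, n = m + 2 := ⟨n - 2, by omega⟩
      have h1 : (c + 1) * esum x S ≤ (c + 1) * m := Nat.mul_le_mul_left _ (by omega)
      nlinarith

/-- Every nonempty subset of `S` with at most `s` elements spans fewer edges than it has
vertices. -/
def LocallyForest (x : Sym2 V → ℕ) (s : ℕ) (S : Finset V) : Prop :=
  ∀ X ⊆ S, X.Nonempty → X.card ≤ s → esum x X + 1 ≤ X.card

/-- Here `g` stands for the extremal number of graphs without short cycles. The induction only needs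
that `g` grows by at least one per vertex and that it dominates trees at s vertices and a single
cycle beyond s. -/
theorem esum_le_of_locallyForest_bound {x : Sym2 V → ℕ} {s : ℕ} {g : ℕ → ℕ} (hs : 1 ≤ s)
    (h : ∀ X : Finset V, X.card = s → esum x X + 1 ≤ s)
    (hforest : ∀ S : Finset V, LocallyForest x s S → esum x S ≤ g S.card)
    (hsucc : ∀ m, 1 ≤ m → g m + 1 ≤ g (m + 1)) (hlarge : ∀ m, s < m → m ≤ g m)
    (hself : s ≤ g s + 1) (S : Finset V) (hS : s ≤ S.card) :
    esum x S ≤ g S.card := by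
  induction hn : S.card using Nat.strong_induction_on generalizing S with
  | _ n ih =>
    rcases hS.eq_or_lt with heq | hlt
    · have := h S heq.symm
      rw [← hn, ← heq]
      omega
    by_cases hdeg : ∀ v ∈ S, 2 ≤ ∑ u ∈ S.erase v, x s(v, u)
    swap
    · push Not at hdeg
      obtain ⟨v, hv, hvd⟩ := hdeg
      have hc := Finset.card_erase_of_mem hv
      have := ih (n - 1) (by omega) (S.erase v) (by omega) (by omega)
      have h1 := hsucc (n - 1) (by omega)
      rw [Nat.sub_add_cancel (by omega)] at h1
      rw [esum_erase x hv]
      omega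
    by_cases hloc : LocallyForest x s S
    · rw [← hn]
      exact hforest S hloc
    obtain ⟨X, hXS, hXc, hXe, hXcl, hmax⟩ := exists_max_dense x S s
    have hX : X.card < s := by
      refine lt_of_le_of_ne hXc fun heq => ?_
      have := h X heq
      omega
    have hcl := hXcl hX
    have hXpos : 1 ≤ X.card := by
      unfold LocallyForest at hloc
      push Not at hloc
      obtain ⟨Z, hZS, hZne, hZc, hZe⟩ := hloc
      have := hmax Z hZS hZc (by omega)
      have := hZne.card_pos
      omega
    have hcS := Finset.card_sdiff_add_card_eq_card hXS
    have hRcl := hcl.compl hXS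
    have hRdeg : ∀ v ∈ S \ X, 2 ≤ ∑ u ∈ (S \ X).erase v, x s(v, u) := fun v hv => by
      rw [hRcl.sum_erase Finset.sdiff_subset hv]
      exact hdeg v (Finset.mem_sdiff.1 hv).1
    have hXdeg : ∀ v ∈ X, 2 ≤ ∑ u ∈ X.erase v, x s(v, u) := fun v hv => by
      rw [hcl.sum_erase hXS hv]
      exact hdeg v (hXS hv)
    -- Complete X to an s-set by a tree-like set from the rest. If X had more edges than vertices,
    -- this s-set would span at least s.
    have hXeq : esum x X = X.card := by
      obtain ⟨Y, hY, hYc, hYe⟩ := exists_card_eq_le_esum hRdeg (k := s - X.card)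
        (by omega) (by omega)
      have hdisj : Disjoint X Y := Finset.disjoint_of_subset_right hY Finset.disjoint_sdiff
      have h1 := esum_union x hdisj
      have h2 := h (X ∪ Y) (by rw [Finset.card_union_of_disjoint hdisj]; omega)
      omega
    rw [hcl.esum_eq hXS, hXeq]
    by_cases hR : s ≤ (S \ X).card
    · have hrec := ih (S \ X).card (by omega) (S \ X) hR rfl
      have hadd : ∀ d, g (S \ X).card + d ≤ g ((S \ X).card + d) := by
        intro d
        induction d with
        | zero => simp
        | succ d ihd =>
          have := hsucc ((S \ X).card + d) (by omega)
          rw [← add_assoc, ← add_assoc]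
          omega
      have := hadd X.card
      rw [hcS, hn] at this
      omega
    -- The rest is too small for induction, so the roles are exchanged: it is completed to an s-set
    -- from inside X.
    · have hRe : esum x (S \ X) ≤ (S \ X).card := by
        by_contra hcon
        have hle := hmax (S \ X) Finset.sdiff_subset (by omega) (by omega)
        obtain ⟨Y, hY, hYc, hYe⟩ := exists_card_eq_le_esum hXdeg (k := s - (S \ X).card)
          (by omega) (by omega)
        have hdisj : Disjoint (S \ X) Y :=
          Finset.disjoint_of_subset_right hY Finset.sdiff_disjoint
        have h1 := esum_union x hdisj
        have h2 := h ((S \ X) ∪ Y) (by rw [Finset.card_union_of_disjoint hdisj]; omega)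
        omega
      have := hlarge n (by omega)
      omega

/-- Pairs of positive weight are collected one at a time, and each adds at most two vertices. -/
theorem exists_card_le_two_mul_le_esum (x : Sym2 V → ℕ) (S : Finset V) {k : ℕ}
    (hk : k ≤ esum x S) : ∃ X ⊆ S, X.card ≤ 2 * k ∧ k ≤ esum x X := by
  induction k with
  | zero => exact ⟨∅, by simp⟩
  | succ k ih =>
    obtain ⟨X, hXS, hXc, hXe⟩ := ih (by omega)
    by_cases hX : k + 1 ≤ esum x X
    · exact ⟨X, hXS, by omega, hX⟩
    · have : ∃ e ∈ pairs S, e ∉ pairs X ∧ x e ≠ 0 := by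
        by_contra! hcon
        have : esum x X = esum x S := Finset.sum_subset (pairs_mono hXS) hcon
        omega
      obtain ⟨e, heS, heX, he⟩ := this
      induction e using Sym2.ind with
      | _ a b =>
        have hab := mk_mem_pairs.1 heS
        refine ⟨insert a (insert b X),
          Finset.insert_subset hab.1 (Finset.insert_subset hab.2.1 hXS), ?_, ?_⟩
        · have h1 := Finset.card_insert_le a (insert b X)
          have h2 := Finset.card_insert_le b X
          omega
        · have hsub : insert s(a, b) (pairs X) ⊆ pairs (insert a (insert b X)) := by
            refine Finset.insert_subset (mk_mem_pairs.2 ⟨by simp, by simp, hab.2.2⟩)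
              (pairs_mono ?_)
            exact (Finset.subset_insert b X).trans (Finset.subset_insert a _)
          have := Finset.sum_le_sum_of_subset (f := x) hsub
          rw [Finset.sum_insert heX] at this
          unfold esum at hXe ⊢
          omega

/-- If every `s`-set spans fewer than `s / 2` edges, then no more edges are spanned altogether. -/
theorem esum_le_of_lt_half {x : Sym2 V → ℕ} {s t : ℕ} (ht : t < s / 2)
    (h : ∀ X : Finset V, X.card = s → esum x X ≤ t) (S : Finset V) (hS : s ≤ S.card) :
    esum x S ≤ t := by
  by_contra! hcon
  obtain ⟨X, hXS, hXc, hXe⟩ := exists_card_le_two_mul_le_esum x S (k := t + 1) hcon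
  obtain ⟨Y, hXY, -, hYc⟩ := Finset.exists_subsuperset_card_eq hXS (n := s) (by omega) hS
  have := h Y hYc
  have := esum_mono x hXY
  omega

end UpperBounds

end ProductTuran

namespace ProductTuran

/-! ### Weighted Kővári–Sós–Turán bound -/

section KovariSosTuran

variable {V : Type*} [DecidableEq V] [Fintype V]

/-- The vertices joined to `v` by an edge. -/
def nbrs (x : Sym2 V → ℕ) (v : V) : Finset V :=
  Finset.univ.filter fun u => u ≠ v ∧ x s(v, u) ≠ 0

theorem card_common_nbrs_le {x : Sym2 V → ℕ} {a b : ℕ}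
    (h : ∀ X : Finset V, X.card = a + b → esum x X < a * b) {A : Finset V} (hA : A.card = a) :
    (Finset.univ.filter fun v => A ⊆ nbrs x v).card ≤ b := by
  by_contra! hcon
  obtain ⟨B, hB, hBc⟩ := Finset.exists_subset_card_eq hcon.le
  have hadj : ∀ u ∈ B, ∀ w ∈ A, w ≠ u ∧ x s(u, w) ≠ 0 := fun u hu w hw => by
    have := (Finset.mem_filter.1 (hB hu)).2 hw
    simpa [nbrs] using this
  have hdisj : Disjoint B A := Finset.disjoint_left.2 fun u hu hu' => (hadj u hu u hu').1 rfl
  have h1 := h (B ∪ A) (by rw [Finset.card_union_of_disjoint hdisj]; omega)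
  rw [esum_union x hdisj] at h1
  have h2 : ∑ _u ∈ B, ∑ _w ∈ A, 1 ≤ ∑ u ∈ B, ∑ w ∈ A, x s(u, w) :=
    Finset.sum_le_sum fun u hu => Finset.sum_le_sum fun w hw =>
      Nat.one_le_iff_ne_zero.2 (hadj u hu w hw).2
  simp only [Finset.sum_const, smul_eq_mul, mul_one, hA, hBc] at h2
  rw [mul_comm] at h2
  omega

/-- Double counting of pairs (v, A) with A an `a`-set of neighbours of v. -/
theorem sum_choose_card_nbrs_le {x : Sym2 V → ℕ} {a b : ℕ}
    (h : ∀ X : Finset V, X.card = a + b → esum x X < a * b) :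
    ∑ v, (nbrs x v).card.choose a ≤ b * (Fintype.card V).choose a := by
  have h1 := Finset.sum_card_bipartiteAbove_eq_sum_card_bipartiteBelow
    (s := (Finset.univ : Finset V)) (t := Finset.univ.powersetCard a)
    (fun v A => A ⊆ nbrs x v)
  have h2 : ∀ v : V, Finset.bipartiteAbove (fun v A => A ⊆ nbrs x v)
      (Finset.univ.powersetCard a) v = (nbrs x v).powersetCard a := by
    intro v
    ext A
    simp [Finset.bipartiteAbove, Finset.mem_powersetCard, and_comm]
  simp only [h2, Finset.card_powersetCard] at h1
  rw [h1]
  refine (Finset.sum_le_card_nsmul _ _ b fun A hA => ?_).trans ?_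
  · exact card_common_nbrs_le h (Finset.mem_powersetCard.1 hA).2
  · rw [Finset.card_powersetCard, smul_eq_mul, mul_comm, Finset.card_univ]

/-- A weighted form of the Kővári–Sós–Turán theorem. -/
theorem kovari_sos_turan {x : Sym2 V → ℕ} {k b M : ℕ}
    (h : ∀ X : Finset V, X.card = k + 1 + b → esum x X < (k + 1) * b)
    (hM : ∀ u v, u ≠ v → x s(u, v) ≤ M) :
    ∃ D : ℕ, esum x Finset.univ ≤ M * (D + k * Fintype.card V) ∧
      D ^ (k + 1) ≤ b * Fintype.card V ^ (2 * k + 1) := by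
  -- Truncated degrees are used because (d - k)^(k+1) is at most the falling factorial d(d - 1)⋯(d -
  -- k), also for d < k. The power mean inequality then bounds `D`.
  refine ⟨∑ v, ((nbrs x v).card - k), ?_, ?_⟩
  · have h1 : ∀ v ∈ (Finset.univ : Finset V), ∑ u ∈ Finset.univ.erase v, x s(v, u) ≤
        M * ((nbrs x v).card - k + k) := by
      intro v _
      have : ∑ u ∈ nbrs x v, x s(v, u) = ∑ u ∈ Finset.univ.erase v, x s(v, u) := by
        refine Finset.sum_subset (fun u hu => ?_) fun u hu hu' => ?_
        · simp only [nbrs, Finset.mem_filter] at hu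
          simp [hu.2.1]
        · by_contra hne
          simp only [Finset.mem_erase] at hu
          exact hu' (by simp [nbrs, hu.1, hne])
      rw [← this]
      refine (Finset.sum_le_card_nsmul _ _ M fun u hu => ?_).trans ?_
      · exact hM v u (Finset.mem_filter.1 hu).2.1.symm
      · rw [smul_eq_mul, mul_comm]
        exact Nat.mul_le_mul_left _ (by omega)
    have h2 := Finset.sum_le_sum h1
    rw [sum_sum_erase, ← Finset.mul_sum, Finset.sum_add_distrib] at h2
    simp only [Finset.sum_const, smul_eq_mul, Finset.card_univ] at h2
    rw [mul_comm k]
    omega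
  · have h1 : ∑ v, ((nbrs x v).card - k) ^ (k + 1) ≤ b * Fintype.card V ^ (k + 1) := by
      calc ∑ v, ((nbrs x v).card - k) ^ (k + 1)
          ≤ ∑ v, (k + 1).factorial * (nbrs x v).card.choose (k + 1) :=
            Finset.sum_le_sum fun v _ => by
              rw [← Nat.descFactorial_eq_factorial_mul_choose]
              simpa using Nat.pow_sub_le_descFactorial (nbrs x v).card (k + 1)
        _ ≤ (k + 1).factorial * (b * (Fintype.card V).choose (k + 1)) := by
            rw [← Finset.mul_sum]
            exact Nat.mul_le_mul_left _ (sum_choose_card_nbrs_le h)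
        _ = b * (Fintype.card V).descFactorial (k + 1) := by
            rw [Nat.descFactorial_eq_factorial_mul_choose]
            ring
        _ ≤ _ := Nat.mul_le_mul_left _ (Nat.descFactorial_le_pow _ _)
    have h2 := pow_sum_le_card_mul_sum_pow (s := (Finset.univ : Finset V))
      (f := fun v => (nbrs x v).card - k) (fun _ _ => Nat.zero_le _) k
    refine h2.trans ?_
    rw [Finset.card_univ, Nat.cast_id]
    refine (Nat.mul_le_mul_left _ h1).trans (le_of_eq ?_)
    ring

end KovariSosTuran

end ProductTuran

namespace ProductTuran

/-! ### From products to sums -/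

section Transfer

variable {n s t : ℕ}

/-- Every `(s, C(s, 2) + t)`-graph with a non-zero product arises by increasing the multiplicities
of the complete graph by an `x` that sums to at most `t` over every `s`-set. -/
theorem exists_esum_of_exPi_ne_zero (hs : 2 ≤ s) (hn : s ≤ n)
    (h0 : exPi n s (s.choose 2 + t) ≠ 0) :
    ∃ x : Sym2 (Fin n) → ℕ, (∀ X : Finset (Fin n), X.card = s → esum x X ≤ t) ∧
      exPi n s (s.choose 2 + t) ≤ 2 ^ esum x Finset.univ := by
  obtain ⟨⟨G, hG, hp⟩, -⟩ := exPi_isGreatest (s.choose 2 + t) hs hn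
  have hpos : ∀ e ∈ pairs (Finset.univ : Finset (Fin n)), G.w e ≠ 0 := by
    intro e he h
    exact h0 (hp ▸ Finset.prod_eq_zero he h)
  refine ⟨fun e => G.w e - 1, fun X hX => ?_, ?_⟩
  · have h1 := hG X hX
    have h2 : G.edgeSum X = esum (fun e => G.w e - 1) X + (pairs X).card := by
      rw [Multigraph.edgeSum, esum, Finset.card_eq_sum_ones, ← Finset.sum_add_distrib]
      refine Finset.sum_congr rfl fun e he => ?_
      have := hpos e (pairs_mono (Finset.subset_univ X) he)
      omega
    rw [card_pairs, hX] at h2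
    omega
  · rw [← hp, Multigraph.edgeProd, esum, ← Finset.prod_pow_eq_pow_sum]
    refine Finset.prod_le_prod' fun e he => ?_
    have := Nat.lt_two_pow_self (n := G.w e - 1)
    omega

theorem two_pow_esum_le_exPi (hs : 2 ≤ s) (hn : s ≤ n) {x : Sym2 (Fin n) → ℕ}
    (hx1 : ∀ e, x e ≤ 1) (hx : ∀ X : Finset (Fin n), X.card = s → esum x X ≤ t) :
    2 ^ esum x Finset.univ ≤ exPi n s (s.choose 2 + t) := by
  have hdiag : ∀ X : Finset (Fin n), ∀ e ∈ pairs X, ¬ e.IsDiag := fun X e he =>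
    (Finset.mem_filter.1 he).2
  let G : Multigraph (Fin n) :=
    ⟨fun e => if e.IsDiag then 0 else 1 + x e, fun e he => by simp [he]⟩
  refine (exPi_isGreatest (s.choose 2 + t) hs hn).2 ⟨G, fun X hX => ?_, ?_⟩
  · have : G.edgeSum X = ∑ e ∈ pairs X, (1 + x e) :=
      Finset.sum_congr rfl fun e he => by simp [G, hdiag X e he]
    rw [this, Finset.sum_add_distrib, ← Finset.card_eq_sum_ones, card_pairs, hX]
    exact Nat.add_le_add_left (hx X hX) _
  · rw [Multigraph.edgeProd, esum, ← Finset.prod_pow_eq_pow_sum]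
    refine Finset.prod_congr rfl fun e he => ?_
    have := hx1 e
    interval_cases h : x e <;> simp [G, hdiag _ e he, h]

theorem exPi_ne_zero (hs : 2 ≤ s) (hn : s ≤ n) : exPi n s (s.choose 2 + t) ≠ 0 := by
  have := two_pow_esum_le_exPi (n := n) (t := t) hs hn (x := fun _ => 0) (by simp)
    (by simp [esum])
  have := Nat.two_pow_pos (esum (fun _ : Sym2 (Fin n) => 0) Finset.univ)
  omega

theorem exPi_le_two_pow (hs : 2 ≤ s) (hn : s ≤ n) {m : ℕ}
    (h : ∀ x : Sym2 (Fin n) → ℕ, (∀ X : Finset (Fin n), X.card = s → esum x X ≤ t) →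
      esum x Finset.univ ≤ m) : exPi n s (s.choose 2 + t) ≤ 2 ^ m := by
  obtain ⟨x, hx, hle⟩ := exists_esum_of_exPi_ne_zero hs hn (exPi_ne_zero (t := t) hs hn)
  exact hle.trans (Nat.pow_le_pow_right Nat.zero_lt_two (h x hx))

theorem exPi_mono {q q' : ℕ} (hs : 2 ≤ s) (hn : s ≤ n) (h : q ≤ q') :
    exPi n s q ≤ exPi n s q' := by
  obtain ⟨⟨G, hG, hp⟩, -⟩ := exPi_isGreatest q hs hn
  exact (exPi_isGreatest q' hs hn).2 ⟨G, fun X hX => (hG X hX).trans h, hp⟩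

theorem exPi_eq_zero {q : ℕ} (hs : 2 ≤ s) (hn : s ≤ n) (h : q < s.choose 2) :
    exPi n s q = 0 := by
  obtain ⟨⟨G, hG, hp⟩, -⟩ := exPi_isGreatest q hs hn
  by_contra h0
  obtain ⟨X, -, hX⟩ := Finset.exists_subset_card_eq
    (s := (Finset.univ : Finset (Fin n))) (n := s) (by simpa using hn)
  have h1 : (pairs X).card ≤ G.edgeSum X := by
    rw [Finset.card_eq_sum_ones]
    refine Finset.sum_le_sum fun e he => Nat.one_le_iff_ne_zero.2 fun hw => h0 ?_
    exact hp ▸ Finset.prod_eq_zero (pairs_mono (Finset.subset_univ X) he) hw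
  rw [card_pairs, hX] at h1
  have := hG X hX
  omega

/-- No multiplicity exceeds the bound on the `s`-sets. -/
theorem apply_le_of_esum_le (hs : 2 ≤ s) (hn : s ≤ n) {x : Sym2 (Fin n) → ℕ}
    (hx : ∀ X : Finset (Fin n), X.card = s → esum x X ≤ t) {e : Sym2 (Fin n)}
    (he : ¬ e.IsDiag) : x e ≤ t := by
  induction e using Sym2.ind with
  | _ a b =>
    obtain ⟨X, hX, hc⟩ := Finset.exists_superset_card_eq
      (s := ({a, b} : Finset (Fin n))) (n := s)
      (le_trans Finset.card_le_two hs) (by simpa using hn)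
    refine le_trans ?_ (hx X hc)
    refine Finset.single_le_sum (f := x) (fun _ _ => Nat.zero_le _) ?_
    exact mk_mem_pairs.2 ⟨hX (by simp), hX (by simp), he⟩

theorem esum_univ_le_mul_sq (hs : 2 ≤ s) (hn : s ≤ n) {x : Sym2 (Fin n) → ℕ}
    (hx : ∀ X : Finset (Fin n), X.card = s → esum x X ≤ t) :
    esum x Finset.univ ≤ t * n ^ 2 := by
  refine (Finset.sum_le_card_nsmul _ _ t fun e he => ?_).trans ?_
  · exact apply_le_of_esum_le hs hn hx (Finset.mem_filter.1 he).2
  · rw [card_pairs, smul_eq_mul, mul_comm]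
    exact Nat.mul_le_mul_left _ (by simpa using Nat.choose_le_pow n 2)

end Transfer

end ProductTuran

namespace ProductTuran

/-! ### Locally sparse weights and graphs without short cycles -/

section Graphs

variable {V W : Type*} [DecidableEq V] [DecidableEq W]

open Classical in
/-- The indicator function of the edges of `H`. -/
noncomputable def edgeIndicator {U : Type*} (H : SimpleGraph U) (e : Sym2 U) : ℕ :=
  if e ∈ H.edgeSet then 1 else 0

theorem edgeIndicator_le_one {U : Type*} (H : SimpleGraph U) (e : Sym2 U) : edgeIndicator H e ≤ 1 := by
  unfold edgeIndicator
  split_ifs <;> simp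

open Classical in
theorem edgeIndicator_mk {U : Type*} (H : SimpleGraph U) (a b : U) :
    edgeIndicator H s(a, b) = if H.Adj a b then 1 else 0 := rfl

theorem edgeIndicator_comap {U U' : Type*} (H : SimpleGraph U) (φ : U' ↪ U) :
    (fun e => edgeIndicator H (e.map φ)) = edgeIndicator (H.comap φ) := by
  ext e
  induction e using Sym2.ind with
  | _ a b =>
    classical
    rw [Sym2.map_mk, edgeIndicator_mk, edgeIndicator_mk]
    exact if_congr Iff.rfl rfl rfl

theorem sum_edgeIndicator_le (H : SimpleGraph V) (v : V) {X Y : Finset V}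
    (h : ∀ u ∈ X, H.Adj v u → u ∈ Y) :
    ∑ u ∈ X, edgeIndicator H s(v, u) ≤ (X ∩ Y).card := by
  rw [← Finset.filter_mem_eq_inter, Finset.card_filter]
  refine Finset.sum_le_sum fun u hu => ?_
  by_cases huv : H.Adj v u
  · simp [edgeIndicator_mk, huv, h u hu huv]
  · simp [edgeIndicator_mk, huv]

theorem esum_edgeIndicator_univ [Fintype V] (H : SimpleGraph V) :
    esum (edgeIndicator H) Finset.univ = H.edgeSet.ncard := by
  classical
  have : H.edgeSet = ((pairs (Finset.univ : Finset V)).filter (· ∈ H.edgeSet) : Finset _) := by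
    ext e
    simp only [pairs, Finset.sym2_univ, Finset.coe_filter, Finset.mem_filter, Finset.mem_univ,
      true_and, Set.mem_ofPred_eq]
    exact ⟨fun h => ⟨H.not_isDiag_of_mem_edgeSet h, h⟩, fun h => h.2⟩
  rw [this, Set.ncard_coe_finset, Finset.card_filter]
  rfl

theorem esum_edgeIndicator [Fintype V] (H : SimpleGraph V) (X : Finset V) :
    esum (edgeIndicator H) X = (H.comap (Function.Embedding.subtype (· ∈ X))).edgeSet.ncard := by
  have hX : X = (Finset.univ : Finset {v // v ∈ X}).map (Function.Embedding.subtype _) := by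
    ext; simp
  conv_lhs => rw [hX]
  rw [esum_map, edgeIndicator_comap, esum_edgeIndicator_univ]

/-- A maximal acyclic extension inside the complete graph is a spanning tree. -/
theorem ncard_edgeSet_lt_of_isAcyclic {U : Type*} [Fintype U] [Nonempty U] {H : SimpleGraph U}
    (h : H.IsAcyclic) : H.edgeSet.ncard + 1 ≤ Fintype.card U := by
  classical
  obtain ⟨F, hHF, hF⟩ := SimpleGraph.exists_maximal_isAcyclic_of_le_isAcyclic le_top h
  have hT : F.IsTree := (SimpleGraph.connected_top.maximal_le_isAcyclic_iff_isTree le_top).1 hF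
  rw [← hT.card_edgeFinset, ← SimpleGraph.coe_edgeFinset H, Set.ncard_coe_finset]
  exact Nat.succ_le_succ (Finset.card_le_card (SimpleGraph.edgeFinset_mono hHF))

/-- No cycle of length between `3` and `s` is a subgraph of `H`. -/
def NoShortCycles (H : SimpleGraph V) (s : ℕ) : Prop :=
  ∀ k : ℕ, 3 ≤ k → k ≤ s → (SimpleGraph.cycleGraph k).Free H

/-- A cycle inside `X` has length at most |X| ≤ s, so the induced graph on `X` is acyclic. -/
theorem NoShortCycles.locallyForest [Fintype V] {H : SimpleGraph V} {s : ℕ}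
    (h : NoShortCycles H s) : LocallyForest (edgeIndicator H) s Finset.univ := by
  intro X _ hX hXs
  rw [esum_edgeIndicator]
  have : Nonempty {v // v ∈ X} := hX.to_subtype
  have hc : Fintype.card {v // v ∈ X} = X.card := by simp
  rw [← hc]
  refine ncard_edgeSet_lt_of_isAcyclic (SimpleGraph.isAcyclic_iff_free_cycleGraph.2 ?_)
  intro k hk hcon
  have hks : k ≤ X.card := by
    obtain ⟨f⟩ := hcon
    simpa using Fintype.card_le_of_injective f f.injective
  refine h k hk (hks.trans hXs) (hcon.trans ?_)
  exact (SimpleGraph.Embedding.comap (Function.Embedding.subtype (· ∈ X)) H).isContained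

theorem le_esum_univ_of_cycle {k : ℕ} {y : Sym2 (Fin k) → ℕ} (hk : 3 ≤ k)
    (h : ∀ u v, (SimpleGraph.cycleGraph k).Adj u v → 1 ≤ y s(u, v)) :
    k ≤ esum y Finset.univ := by
  obtain ⟨m, rfl⟩ : ∃ m, k = m + 3 := ⟨k - 3, by omega⟩
  have h1 : ∀ v ∈ (Finset.univ : Finset (Fin (m + 3))),
      2 ≤ ∑ u ∈ Finset.univ.erase v, y s(v, u) := by
    intro v _
    rw [← SimpleGraph.cycleGraph_degree_three_le (v := v), ← SimpleGraph.card_neighborFinset_eq_degree,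
      Finset.card_eq_sum_ones]
    refine le_trans (Finset.sum_le_sum fun u hu => h v u ?_) (Finset.sum_le_sum_of_subset ?_)
    · simpa using hu
    · intro u hu
      rw [SimpleGraph.mem_neighborFinset] at hu
      simp [hu.ne']
  have h2 := Finset.sum_le_sum h1
  rw [sum_sum_erase] at h2
  simp at h2
  omega

theorem noShortCycles_of_locallyForest [Fintype V] {H : SimpleGraph V} {s : ℕ} {x : Sym2 V → ℕ}
    (hx : LocallyForest x s Finset.univ) (h : ∀ u v, H.Adj u v → 1 ≤ x s(u, v)) :
    NoShortCycles H s := by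
  rintro k hk hks ⟨f⟩
  have h1 := hx (Finset.univ.map ⟨f, f.injective⟩) (Finset.subset_univ _)
    ⟨f ⟨0, by omega⟩, by simp⟩ (by simpa using hks)
  rw [esum_map, Finset.card_map, Finset.card_univ, Fintype.card_fin] at h1
  have := le_esum_univ_of_cycle (y := fun e => x (e.map f)) hk
    fun u v huv => h _ _ (f.toHom.map_adj huv)
  have h2 : (fun e : Sym2 (Fin k) => x (e.map f)) =
    fun e => x (e.map (⟨f, f.injective⟩ : Fin k ↪ V)) := rfl
  rw [h2] at this
  omega

theorem LocallyForest.map {x : Sym2 V → ℕ} {s : ℕ} {φ : W ↪ V} {S : Finset W}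
    (h : LocallyForest x s (S.map φ)) : LocallyForest (fun e => x (e.map φ)) s S := by
  intro X hXS hX hc
  have := h (X.map φ) (Finset.map_subset_map.2 hXS) (hX.map) (by simpa using hc)
  rwa [esum_map, Finset.card_map] at this

/-- Since s ≥ 2, the condition on two-element sets forces weights at most 1 on pairs. So x is the
indicator of a graph on `S`, and a k-cycle in it with k ≤ s would span k edges on k vertices. -/
theorem esum_le_exCycles {x : Sym2 V → ℕ} {s : ℕ} (hs : 2 ≤ s) {S : Finset V}
    (h : LocallyForest x s S) : esum x S ≤ exCycles S.card s := by
  let φ : Fin S.card ↪ V := S.equivFin.symm.toEmbedding.trans (Function.Embedding.subtype _)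
  have hφ : (Finset.univ : Finset (Fin S.card)).map φ = S := by
    ext v
    simp only [Finset.mem_map, Finset.mem_univ, true_and]
    exact ⟨fun ⟨i, hi⟩ => hi ▸ (S.equivFin.symm i).2, fun hv => ⟨S.equivFin ⟨v, hv⟩, by simp [φ]⟩⟩
  rw [← hφ] at h
  have hy := h.map
  conv_lhs => rw [← hφ, esum_map]
  set y : Sym2 (Fin S.card) → ℕ := fun e => x (e.map φ)
  have hy1 : ∀ a b, a ≠ b → y s(a, b) ≤ 1 := by
    intro a b hab
    have h1 := hy {a, b} (Finset.subset_univ _) (by simp)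
      (by rw [Finset.card_pair hab]; exact hs)
    rw [esum_insert _ (by simpa using hab), Finset.card_pair hab] at h1
    simp at h1
    omega
  let H : SimpleGraph (Fin S.card) := SimpleGraph.fromEdgeSet {e | y e ≠ 0}
  have hH : esum y Finset.univ = esum (edgeIndicator H) Finset.univ := by
    refine Finset.sum_congr rfl fun e he => ?_
    induction e using Sym2.ind with
    | _ a b =>
      have hab := (mk_mem_pairs.1 he).2.2
      have h1 := hy1 a b hab
      rw [edgeIndicator_mk]
      interval_cases hyab : y s(a, b) <;> simp [H, hyab, hab]
  rw [hH, esum_edgeIndicator_univ]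
  refine (exCycles_isGreatest S.card s).2 ⟨H, noShortCycles_of_locallyForest hy ?_, rfl⟩
  intro u v huv
  have := ((SimpleGraph.fromEdgeSet_adj _).1 huv).1
  exact Nat.one_le_iff_ne_zero.2 this

theorem exists_locallyForest_esum_eq_exCycles (n s : ℕ) :
    ∃ x : Sym2 (Fin n) → ℕ, (∀ e, x e ≤ 1) ∧ LocallyForest x s Finset.univ ∧
      esum x Finset.univ = exCycles n s := by
  obtain ⟨⟨H, hH, hc⟩, -⟩ := exCycles_isGreatest n s
  exact ⟨edgeIndicator H, edgeIndicator_le_one H, NoShortCycles.locallyForest hH,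
    (esum_edgeIndicator_univ H).trans hc⟩

/-- The n-cycle is a witness: a nonempty set of at most s < n vertices misses the successor of one
of its members, so one degree inside it is below 2. -/
theorem le_exCycles {n s : ℕ} (hs : 2 ≤ s) (hn : s < n) : n ≤ exCycles n s := by
  classical
  obtain ⟨m, rfl⟩ : ∃ m, n = m + 3 := ⟨n - 3, by omega⟩
  set x := edgeIndicator (SimpleGraph.cycleGraph (m + 3)) with hx
  have hadj : ∀ u v, (SimpleGraph.cycleGraph (m + 3)).Adj u v → 1 ≤ x s(u, v) := by
    intro u v huv
    simp [hx, edgeIndicator_mk, huv]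
  have hdeg : ∀ (X : Finset (Fin (m + 3))) v, ∑ u ∈ X.erase v, x s(v, u) ≤
      (X ∩ {v - 1, v + 1}).card := by
    intro X v
    refine (sum_edgeIndicator_le (Y := {v - 1, v + 1}) _ v fun u _ hu => ?_).trans
      (Finset.card_le_card (Finset.inter_subset_inter_right (Finset.erase_subset v X)))
    rwa [← SimpleGraph.mem_neighborFinset, SimpleGraph.cycleGraph_neighborFinset] at hu
  have hloc : LocallyForest x s (Finset.univ : Finset (Fin (m + 3))) := by
    intro X _ hX hc
    have h2 : ∀ v ∈ X, ∑ u ∈ X.erase v, x s(v, u) ≤ 2 := fun v _ =>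
      (hdeg X v).trans ((Finset.card_le_card Finset.inter_subset_right).trans Finset.card_le_two)
    have h1 : ∃ v ∈ X, ∑ u ∈ X.erase v, x s(v, u) < 2 := by
      obtain ⟨v, hv, hv1⟩ : ∃ v ∈ X, v + 1 ∉ X := by
        by_contra! hcon
        obtain ⟨a, ha⟩ := hX
        have hall : ∀ j : ℕ, a + Fin.ofNat (m + 3) j ∈ X := by
          intro j
          induction j with
          | zero => simpa using ha
          | succ j ih =>
            have : Fin.ofNat (m + 3) (j + 1) = Fin.ofNat (m + 3) j + 1 :=
              Fin.ext (by simp [Fin.ofNat, Fin.val_add])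
            rw [this, ← add_assoc]
            exact hcon _ ih
        have : X = Finset.univ := by
          ext b
          simpa using hall (b - a).val
        rw [this] at hc
        simp at hc
        omega
      refine ⟨v, hv, (hdeg X v).trans_lt ?_⟩
      have : X ∩ {v - 1, v + 1} ⊆ {v - 1} := by
        intro u hu
        simp only [Finset.mem_inter, Finset.mem_insert, Finset.mem_singleton] at hu ⊢
        rcases hu.2 with h | h
        · exact h
        · exact absurd (h ▸ hu.1) hv1
      have := Finset.card_le_card this
      simp at this
      omega
    have := Finset.sum_lt_sum h2 h1
    rw [sum_sum_erase] at this
    simp at this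
    omega
  have h1 := esum_le_exCycles hs hloc
  have h2 := le_esum_univ_of_cycle (by omega) hadj
  simp only [Finset.card_univ, Fintype.card_fin] at h1
  omega

/-- A pendant edge, from the new vertex `none` to `r`, creates no cycle. -/
theorem exCycles_succ {m s : ℕ} (hs : 2 ≤ s) (hm : 1 ≤ m) :
    exCycles m s + 1 ≤ exCycles (m + 1) s := by
  obtain ⟨⟨H, hH, hc⟩, -⟩ := exCycles_isGreatest m s
  have hloc : LocallyForest (edgeIndicator H) s Finset.univ := NoShortCycles.locallyForest hH
  let φ : Fin m ↪ Option (Fin m) := Function.Embedding.some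
  let r : Fin m := ⟨0, hm⟩
  let K : SimpleGraph (Option (Fin m)) := H.map φ ⊔ SimpleGraph.edge none (some r)
  have hcomap : K.comap φ = H := by
    ext a b
    rw [SimpleGraph.comap_adj, SimpleGraph.sup_adj, SimpleGraph.map_adj_apply]
    simp [φ, SimpleGraph.edge_adj]
  have hnone : ∀ u, K.Adj none u ↔ u = some r := by
    intro u
    rw [SimpleGraph.sup_adj, SimpleGraph.map_adj, SimpleGraph.edge_adj]
    cases u <;> simp [φ]
  have hloc' : LocallyForest (edgeIndicator K) s Finset.univ := by
    have key : ∀ X : Finset (Option (Fin m)), none ∉ X → X.Nonempty → X.card ≤ s →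
        esum (edgeIndicator K) X + 1 ≤ X.card := by
      intro X hX hXne hXs
      obtain ⟨Y, rfl⟩ : ∃ Y : Finset (Fin m), X = Y.map φ := by
        refine ⟨X.eraseNone, ?_⟩
        rw [Finset.map_some_eraseNone, Finset.erase_eq_of_notMem hX]
      rw [esum_map, edgeIndicator_comap, hcomap, Finset.card_map]
      exact hloc Y (Finset.subset_univ _) (by simpa using hXne) (by simpa using hXs)
    intro X _ hXne hXs
    by_cases hX : none ∈ X
    · have h1 : ∑ u ∈ X.erase none, edgeIndicator K s(none, u) ≤ 1 := by
        refine (sum_edgeIndicator_le (Y := {some r}) K none fun u _ hu => ?_).trans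
          ((Finset.card_le_card Finset.inter_subset_right).trans (Finset.card_singleton _).le)
        simpa using (hnone u).1 hu
      have hcX := Finset.card_erase_of_mem hX
      rcases (X.erase none).eq_empty_or_nonempty with he | hne
      · rw [esum_erase _ hX, he]
        simpa using hXne
      · have := key (X.erase none) (Finset.notMem_erase _ _) hne (by omega)
        rw [esum_erase _ hX]
        have := hne.card_pos
        omega
    · exact key X hX hXne hXs
  have h1 := esum_le_exCycles hs hloc'
  have h2 : (Finset.univ : Finset (Option (Fin m))).erase none = Finset.univ.map φ := by
    ext u
    cases u <;> simp [φ]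
  rw [esum_erase _ (Finset.mem_univ none), h2, esum_map, edgeIndicator_comap, hcomap,
    esum_edgeIndicator_univ, hc] at h1
  have h3 : 1 ≤ ∑ u ∈ Finset.univ.map φ, edgeIndicator K s(none, u) := by
    have : edgeIndicator K s(none, some r) = 1 := by simp [edgeIndicator_mk, hnone]
    rw [← this]
    exact Finset.single_le_sum (f := fun u => edgeIndicator K s(none, u))
      (fun _ _ => Nat.zero_le _) (by simp [φ])
  simp only [Finset.card_univ, Fintype.card_option, Fintype.card_fin] at h1
  omega

theorem le_exCycles_add_one {m s : ℕ} (hs : 2 ≤ s) (hm : 1 ≤ m) : m ≤ exCycles m s + 1 := by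
  induction m, hm using Nat.le_induction with
  | base => omega
  | succ m hm ih =>
    have := exCycles_succ hs hm
    omega

end Graphs

end ProductTuran

namespace ProductTuran

/-! ### Disjoint stars and the even-odd bipartite graph -/

section Constructions

variable {n : ℕ}

/-- The smallest element of the block of `b` consecutive numbers that contains `i`. -/
def blockMin (b : ℕ) (i : Fin n) : Fin n :=
  ⟨i - i % b, (Nat.sub_le _ _).trans_lt i.2⟩

open Classical in
/-- The indicator function of the disjoint union of the stars on the blocks of `b` consecutive
numbers, each centred at its smallest element. -/
noncomputable def blockStars (n b : ℕ) (e : Sym2 (Fin n)) : ℕ :=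
  if ∃ i : Fin n, e = s(blockMin b i, i) then 1 else 0

theorem blockMin_le (b : ℕ) (i : Fin n) : blockMin b i ≤ i :=
  Nat.sub_le _ _

theorem esum_blockStars_le (b : ℕ) (X : Finset (Fin n)) :
    esum (blockStars n b) X ≤
      (X.filter fun i => blockMin b i ∈ X ∧ blockMin b i ≠ i).card := by
  classical
  rw [esum]
  unfold blockStars
  rw [← Finset.card_filter]
  refine (Finset.card_le_card (t := (X.filter fun i => blockMin b i ∈ X ∧ blockMin b i ≠ i).image
    fun i => s(blockMin b i, i)) fun e he => ?_).trans Finset.card_image_le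
  obtain ⟨he, i, rfl⟩ := Finset.mem_filter.1 he
  have := mk_mem_pairs.1 he
  exact Finset.mem_image.2 ⟨i, Finset.mem_filter.2 ⟨this.2.1, this.1, this.2.2⟩, rfl⟩

theorem le_esum_blockStars (b : ℕ) :
    (Finset.univ.filter fun i : Fin n => blockMin b i ≠ i).card ≤
      esum (blockStars n b) Finset.univ := by
  classical
  rw [esum]
  unfold blockStars
  rw [← Finset.card_filter]
  refine Finset.card_le_card_of_injOn (fun i => s(blockMin b i, i)) (fun i hi => ?_) ?_
  · simp only [Finset.coe_filter, Finset.mem_univ, true_and, Set.mem_ofPred_eq] at hi ⊢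
    exact ⟨mk_mem_pairs.2 ⟨Finset.mem_univ _, Finset.mem_univ _, hi⟩, i, rfl⟩
  · intro i hi j hj hij
    simp only [Finset.coe_filter, Finset.mem_univ, true_and, Set.mem_ofPred_eq] at hi hj
    rcases Sym2.eq_iff.1 hij with h | h
    · exact h.2
    · have h1 := blockMin_le b i
      have h2 := blockMin_le b j
      rw [h.1] at h1
      rw [← h.2] at h2
      exact le_antisymm h2 h1

/-- The centres are the multiples of c + 1 below n, at most ⌈n/(c+1)⌉ of them. -/
theorem card_blockMin_ne {c : ℕ} :
    c * n / (c + 1) ≤ (Finset.univ.filter fun i : Fin n => blockMin (c + 1) i ≠ i).card := by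
  have h1 : (Finset.univ.filter fun i : Fin n => ¬ blockMin (c + 1) i ≠ i).card ≤
      (Finset.range ((n + c) / (c + 1))).card := by
    have hmod : ∀ i : Fin n, ¬ blockMin (c + 1) i ≠ i → (c + 1) * (i.val / (c + 1)) = i.val := by
      intro i hi
      have h2 := congrArg Fin.val (not_not.1 hi)
      simp only [blockMin] at h2
      have := Nat.div_add_mod i.val (c + 1)
      omega
    refine Finset.card_le_card_of_injOn (fun i => i.val / (c + 1)) (fun i hi => ?_) ?_
    · have h2 := hmod i (Finset.mem_filter.1 hi).2
      have h3 := i.2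
      rw [Finset.coe_range, Set.mem_Iio, Nat.lt_iff_add_one_le, Nat.le_div_iff_mul_le (by omega)]
      change (i.val / (c + 1) + 1) * (c + 1) ≤ n + c
      have : (i.val / (c + 1) + 1) * (c + 1) = (c + 1) * (i.val / (c + 1)) + (c + 1) := by ring
      omega
    · intro i hi j hj hij
      have h2 := hmod i (Finset.mem_filter.1 hi).2
      have h3 := hmod j (Finset.mem_filter.1 hj).2
      simp only at hij
      ext
      rw [← h2, ← h3, hij]
  have h2 := Finset.card_filter_add_card_filter_not (s := (Finset.univ : Finset (Fin n)))
    (fun i => blockMin (c + 1) i ≠ i)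
  rw [Finset.card_range] at h1
  rw [Finset.card_univ, Fintype.card_fin] at h2
  have h3 := Nat.div_mul_le_self (n + c) (c + 1)
  rw [← Nat.lt_add_one_iff, Nat.div_lt_iff_lt_mul (by omega)]
  nlinarith

theorem esum_blockStars_le_of_card {c : ℕ} {X : Finset (Fin n)} (hX : X.card = c + 2) :
    esum (blockStars n (c + 1)) X ≤ c := by
  refine (esum_blockStars_le _ _).trans ?_
  -- For P constant on blocks, the smallest member of `X` satisfying P is not counted as a leaf: its
  -- centre, if in `X`, satisfies P too and cannot be smaller. As c + 2 vertices meet two blocks,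
  -- this is used twice.
  have hex : ∀ P : Fin n → Prop, (∀ i j : Fin n, i.val / (c + 1) = j.val / (c + 1) → P i → P j) →
      (∃ i ∈ X, P i) → ∃ i ∈ X, P i ∧ ¬ (blockMin (c + 1) i ∈ X ∧ blockMin (c + 1) i ≠ i) := by
    classical
    rintro P hP ⟨i, hi, hPi⟩
    obtain ⟨j, hj, hmin⟩ := (X.filter P).exists_min_image id ⟨i, by simp [hi, hPi]⟩
    simp only [Finset.mem_filter, id] at hj hmin
    refine ⟨j, hj.1, hj.2, fun hcon => hcon.2 ?_⟩
    refine le_antisymm (blockMin_le _ _) (hmin _ ⟨hcon.1, hP j _ ?_ hj.2⟩)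
    exact Nat.div_eq_sub_mod_div
  obtain ⟨u, hu, -, huN⟩ := hex (fun _ => True) (fun _ _ _ _ => trivial) (by
    obtain ⟨i, hi⟩ := Finset.card_pos.1 (by omega : 0 < X.card)
    exact ⟨i, hi, trivial⟩)
  obtain ⟨v, hv, huv, hvN⟩ := hex (fun i => i.val / (c + 1) ≠ u.val / (c + 1))
    (fun i j hij h => hij ▸ h) (by
      by_contra! hcon
      have : X.card ≤ (Finset.range (c + 1)).card := by
        refine Finset.card_le_card_of_injOn (fun i => i.val % (c + 1)) (fun i _ => ?_) ?_
        · simpa using Nat.mod_lt _ (Nat.succ_pos c)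
        · intro i hi j hj hij
          have h1 := hcon i hi
          have h2 := hcon j hj
          have h3 := Nat.div_add_mod i.val (c + 1)
          have h4 := Nat.div_add_mod j.val (c + 1)
          simp only at hij
          ext
          rw [← h3, ← h4, h1, h2, hij]
      simp at this
      omega)
  have hne : u ≠ v := fun h => huv (h ▸ rfl)
  have : (X.filter fun i => blockMin (c + 1) i ∈ X ∧ blockMin (c + 1) i ≠ i) ⊆ X \ {u, v} := by
    intro i hi
    simp only [Finset.mem_filter, Finset.mem_sdiff, Finset.mem_insert, Finset.mem_singleton] at hi ⊢
    refine ⟨hi.1, ?_⟩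
    rintro (rfl | rfl)
    · exact huN hi.2
    · exact hvN hi.2
  have h1 := Finset.card_le_card this
  rw [Finset.card_sdiff_of_subset (by
    intro i hi
    simp only [Finset.mem_insert, Finset.mem_singleton] at hi
    rcases hi with rfl | rfl <;> assumption), Finset.card_pair hne, hX] at h1
  omega

theorem esum_blockStars_two_le (X : Finset (Fin n)) : esum (blockStars n 2) X ≤ X.card / 2 := by
  set A := X.filter fun i => blockMin 2 i ∈ X ∧ blockMin 2 i ≠ i
  have hXA : esum (blockStars n 2) X ≤ A.card := esum_blockStars_le 2 X
  have hval : ∀ i : Fin n, blockMin 2 i ≠ i → i.val % 2 = 1 := by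
    intro i hi
    by_contra h
    have h0 : i.val % 2 = 0 := by omega
    exact hi (Fin.ext (by simp [blockMin, h0]))
  -- For blocks of size 2 the counted vertices are odd; their centres are even, distinct and in `X`.
  have hle : A.card ≤ (X \ A).card := by
    refine Finset.card_le_card_of_injOn (blockMin 2) (fun i hi => ?_) ?_
    · have hi := (Finset.mem_filter.1 hi).2
      refine Finset.mem_coe.2 (Finset.mem_sdiff.2 ⟨hi.1, fun h => ?_⟩)
      have h1 := hval _ (Finset.mem_filter.1 h).2.2
      simp only [blockMin] at h1
      omega
    · intro i hi j hj hij
      have h1 := hval _ (Finset.mem_filter.1 hi).2.2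
      have h2 := hval _ (Finset.mem_filter.1 hj).2.2
      have h3 := congrArg Fin.val hij
      simp only [blockMin] at h3
      ext
      omega
  have hAX : A ⊆ X := Finset.filter_subset _ X
  have := Finset.card_sdiff_add_card_eq_card hAX
  omega

/-- The indicator function of the complete bipartite graph between even and odd numbers. -/
def evenOdd (n : ℕ) (e : Sym2 (Fin n)) : ℕ :=
  Sym2.lift ⟨fun i j => if i.val % 2 = j.val % 2 then 0 else 1, fun i j => by
    simp only [eq_comm]⟩ e

theorem evenOdd_le_one (e : Sym2 (Fin n)) : evenOdd n e ≤ 1 := by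
  induction e using Sym2.ind with
  | _ a b =>
    simp only [evenOdd, Sym2.lift_mk]
    split_ifs <;> simp

theorem esum_evenOdd (X : Finset (Fin n)) :
    esum (evenOdd n) X =
      (X.filter fun i => i.val % 2 = 0).card * (X.filter fun i => ¬ i.val % 2 = 0).card := by
  conv_lhs => rw [← Finset.filter_union_filter_not_eq (fun i : Fin n => i.val % 2 = 0) X]
  have hzero : ∀ Y : Finset (Fin n), (∀ a ∈ Y, ∀ b ∈ Y, a.val % 2 = b.val % 2) →
      esum (evenOdd n) Y = 0 := by
    intro Y hY
    refine Finset.sum_eq_zero fun e he => ?_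
    induction e using Sym2.ind with
    | _ a b =>
      have := mk_mem_pairs.1 he
      simp [evenOdd, hY a this.1 b this.2.1]
  rw [esum_union _ (Finset.disjoint_filter_filter_not _ _ _), hzero, hzero, zero_add, zero_add]
  · rw [← smul_eq_mul, ← Finset.sum_const]
    refine Finset.sum_congr rfl fun a ha => ?_
    rw [Finset.card_eq_sum_ones]
    refine Finset.sum_congr rfl fun b hb => ?_
    simp only [Finset.mem_filter] at ha hb
    simp only [evenOdd, Sym2.lift_mk]
    rw [if_neg]
    omega
  · intro a ha b hb
    simp only [Finset.mem_filter] at ha hb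
    omega
  · intro a ha b hb
    simp only [Finset.mem_filter] at ha hb
    omega

theorem esum_evenOdd_le (X : Finset (Fin n)) : esum (evenOdd n) X ≤ X.card ^ 2 / 4 := by
  rw [esum_evenOdd, Nat.le_div_iff_mul_le (by norm_num),
    ← Finset.card_filter_add_card_filter_not (s := X) (fun i => i.val % 2 = 0)]
  refine le_trans (le_of_eq ?_) (four_mul_le_sq_add _ _)
  ring

theorem le_esum_evenOdd : (n / 2) * (n / 2) ≤ esum (evenOdd n) Finset.univ := by
  rw [esum_evenOdd]
  refine Nat.mul_le_mul ?_ ?_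
  · conv_lhs => rw [← Finset.card_range (n / 2)]
    refine Finset.card_le_card_of_surjOn (fun i : Fin n => i.val / 2) fun j hj => ?_
    have hj : j < n / 2 := by simpa using hj
    exact ⟨⟨2 * j, by omega⟩, by simp, by simp⟩
  · conv_lhs => rw [← Finset.card_range (n / 2)]
    refine Finset.card_le_card_of_surjOn (fun i : Fin n => i.val / 2) fun j hj => ?_
    have hj : j < n / 2 := by simpa using hj
    exact ⟨⟨2 * j + 1, by omega⟩, by simp [Nat.add_mod], by simp; omega⟩

end Constructions

end ProductTuran

namespace ProductTuran

/-! ### Exact values and asymptotics -/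

section Values

variable {n s t : ℕ}

theorem exPi_choose_two (hs : 2 ≤ s) (hn : s ≤ n) : exPi n s (s.choose 2) = 1 := by
  have h1 := exPi_ne_zero (t := 0) hs hn
  have h2 : exPi n s (s.choose 2 + 0) ≤ 2 ^ 0 := exPi_le_two_pow hs hn fun x hx => by
    simpa using esum_univ_le_mul_sq hs hn hx
  simp only [add_zero, pow_zero] at h1 h2
  omega

theorem exPi_of_lt_half (hs : 2 ≤ s) (hn : s ≤ n) (ht : t < s / 2) :
    exPi n s (s.choose 2 + t) = 2 ^ t := by
  refine le_antisymm (exPi_le_two_pow hs hn fun x hx =>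
    esum_le_of_lt_half ht hx _ (by simpa using hn)) ?_
  have hcard : t ≤ (pairs (Finset.univ : Finset (Fin n))).card := by
    rw [card_pairs, Finset.card_univ, Fintype.card_fin]
    have h1 : n ≤ 2 * n.choose 2 := by
      rw [Nat.choose_two_right, Nat.mul_div_cancel' (Nat.even_mul_pred_self n).two_dvd]
      exact Nat.le_mul_of_pos_right n (by omega)
    omega
  -- Any t pairs of multiplicity 2 attain the bound.
  obtain ⟨T, hT, hTc⟩ := Finset.exists_subset_card_eq hcard
  have hsum : ∀ X : Finset (Fin n), esum (fun e => if e ∈ T then 1 else 0) X =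
      (pairs X ∩ T).card := fun X => by
    rw [esum, ← Finset.card_filter, Finset.filter_mem_eq_inter]
  have h := two_pow_esum_le_exPi (n := n) (s := s) (t := t) hs hn
    (x := fun e => if e ∈ T then 1 else 0) (fun e => by split_ifs <;> simp) (fun X _ => by
      rw [hsum, ← hTc]
      exact Finset.card_le_card Finset.inter_subset_right)
  rwa [hsum, Finset.inter_eq_right.2 hT, hTc] at h

theorem exPi_of_eq_sub_two (hs : 2 ≤ s) (hn : s ≤ n) :
    exPi n s (s.choose 2 + (s - 2)) = 2 ^ ((s - 2) * n / (s - 1)) := by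
  obtain ⟨c, rfl⟩ : ∃ c, s = c + 2 := ⟨s - 2, by omega⟩
  rw [show c + 2 - 2 = c by omega, show c + 2 - 1 = c + 1 by omega]
  refine le_antisymm (exPi_le_two_pow hs hn fun x hx => ?_) ?_
  · rw [Nat.le_div_iff_mul_le (by omega), mul_comm]
    simpa using mul_esum_le hx Finset.univ (by simpa using hn)
  · refine le_trans (Nat.pow_le_pow_right Nat.zero_lt_two
      (card_blockMin_ne.trans (le_esum_blockStars (c + 1)))) ?_
    refine two_pow_esum_le_exPi hs hn (fun e => ?_) fun X hX => esum_blockStars_le_of_card hX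
    unfold blockStars
    split_ifs <;> simp

theorem exPi_of_eq_sub_one (hs : 2 ≤ s) (hn : s ≤ n) :
    exPi n s (s.choose 2 + (s - 1)) = 2 ^ exCycles n s := by
  refine le_antisymm (exPi_le_two_pow hs hn fun x hx => ?_) ?_
  · have := esum_le_of_locallyForest_bound (x := x) (g := fun m => exCycles m s) (by omega : 1 ≤ s)
      (fun X hX => by have := hx X hX; omega) (fun S hS => esum_le_exCycles hs hS)
      (fun m hm => exCycles_succ hs hm) (fun m hm => le_exCycles hs hm)
      (le_exCycles_add_one hs (by omega)) Finset.univ (by simpa using hn)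
    simpa using this
  · obtain ⟨x, hx1, hloc, hx⟩ := exists_locallyForest_esum_eq_exCycles n s
    rw [← hx]
    refine two_pow_esum_le_exPi hs hn hx1 fun X hX => ?_
    have := hloc X (Finset.subset_univ X) (Finset.card_pos.1 (by omega)) hX.le
    omega

theorem rpow_logb_exPi (hs : 2 ≤ s) (hn : s ≤ n) :
    (exPi n s (s.choose 2 + t) : ℝ) = (2 : ℝ) ^ Real.logb 2 (exPi n s (s.choose 2 + t)) := by
  rw [Real.rpow_logb (by norm_num) (by norm_num)]
  exact_mod_cast Nat.pos_of_ne_zero (exPi_ne_zero hs hn)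

theorem logb_exPi_nonneg : 0 ≤ Real.logb 2 (exPi n s t) := by
  rcases Nat.eq_zero_or_pos (exPi n s t) with h | h
  · simp [h]
  · exact Real.logb_nonneg (by norm_num) (by exact_mod_cast h)

theorem logb_two_le {N m : ℕ} (h : N ≤ 2 ^ m) (hN : N ≠ 0) : Real.logb 2 N ≤ m := by
  rw [Real.logb_le_iff_le_rpow (by norm_num) (by exact_mod_cast Nat.pos_of_ne_zero hN),
    Real.rpow_natCast]
  exact_mod_cast h

theorem le_logb_two {N m : ℕ} (h : 2 ^ m ≤ N) : (m : ℝ) ≤ Real.logb 2 N := by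
  have hN : 0 < N := (Nat.two_pow_pos m).trans_le h
  rw [Real.le_logb_iff_rpow_le (by norm_num) (by exact_mod_cast hN), Real.rpow_natCast]
  exact_mod_cast h

theorem isTheta_of_eventually_le {f g : ℕ → ℝ} {c C : ℝ} (hc : 0 < c) (hg : ∀ n, 0 ≤ g n)
    (hl : ∀ᶠ n in atTop, c * g n ≤ f n) (hu : ∀ᶠ n in atTop, f n ≤ C * g n) :
    f =Θ[atTop] g := by
  refine ⟨IsBigO.of_bound C ?_, IsBigO.of_bound c⁻¹ ?_⟩
  · filter_upwards [hl, hu] with n h1 h2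
    rw [Real.norm_of_nonneg ((mul_nonneg hc.le (hg n)).trans h1), Real.norm_of_nonneg (hg n)]
    exact h2
  · filter_upwards [hl] with n h1
    rw [Real.norm_of_nonneg ((mul_nonneg hc.le (hg n)).trans h1), Real.norm_of_nonneg (hg n),
      le_inv_mul_iff₀ hc]
    exact h1

theorem logb_exPi_isTheta_linear (hs : 2 ≤ s) (h1 : s / 2 ≤ t) (h2 : t ≤ s - 2) :
    (fun n => Real.logb 2 (exPi n s (s.choose 2 + t))) =Θ[atTop] fun n : ℕ => (n : ℝ) := by
  refine isTheta_of_eventually_le (c := 1 / 4) (C := 1) (by norm_num) (fun n => n.cast_nonneg) ?_ ?_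
  · filter_upwards [eventually_ge_atTop s] with n hn
    -- Blocks of size 2 form a matching with ⌊n/2⌋ ≥ n/4 edges; `1 + 1` matches the form c + 1 with
    -- c = 1.
    have hstars := card_blockMin_ne.trans (le_esum_blockStars (n := n) (1 + 1))
    have h3 := two_pow_esum_le_exPi (t := t) hs hn (x := blockStars n (1 + 1)) (fun e => by
      unfold blockStars
      split_ifs <;> simp) fun X hX => (esum_blockStars_two_le X).trans (by omega)
    have h4 := le_logb_two h3
    have h5 : n ≤ 4 * esum (blockStars n (1 + 1)) Finset.univ := by omega
    have h6 : (n : ℝ) ≤ 4 * (esum (blockStars n (1 + 1)) Finset.univ : ℕ) := by exact_mod_cast h5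
    linarith
  · filter_upwards [eventually_ge_atTop s] with n hn
    rw [one_mul]
    refine logb_two_le ?_ (exPi_ne_zero hs hn)
    refine (exPi_mono hs hn (Nat.add_le_add_left h2 _)).trans ?_
    rw [exPi_of_eq_sub_two hs hn]
    refine Nat.pow_le_pow_right Nat.zero_lt_two (Nat.div_le_of_le_mul ?_)
    exact Nat.mul_le_mul_right n (by omega)

theorem logb_exPi_isTheta_quadratic (hs : 2 ≤ s) (h1 : s ^ 2 / 4 ≤ t) :
    (fun n => Real.logb 2 (exPi n s (s.choose 2 + t))) =Θ[atTop] fun n : ℕ => (n : ℝ) ^ 2 := by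
  refine isTheta_of_eventually_le (c := 1 / 16) (C := t) (by norm_num) (fun n => by positivity) ?_ ?_
  · filter_upwards [eventually_ge_atTop s] with n hn
    have h3 := two_pow_esum_le_exPi (t := t) hs hn (x := evenOdd n) evenOdd_le_one
      fun X hX => (esum_evenOdd_le X).trans (by rwa [hX])
    have h4 := le_logb_two h3
    have h5 : (((n / 2 : ℕ) * (n / 2 : ℕ) : ℕ) : ℝ) ≤ (esum (evenOdd n) Finset.univ : ℕ) := by
      exact_mod_cast le_esum_evenOdd
    have h6 : (n : ℝ) ≤ 4 * (n / 2 : ℕ) := by exact_mod_cast (by omega : n ≤ 4 * (n / 2))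
    push_cast at h5 h6
    have h7 : (0 : ℝ) ≤ n := n.cast_nonneg
    nlinarith
  · filter_upwards [eventually_ge_atTop s] with n hn
    have := logb_two_le (exPi_le_two_pow (t := t) hs hn fun x hx => esum_univ_le_mul_sq hs hn hx)
      (exPi_ne_zero hs hn)
    exact_mod_cast this

theorem logb_exPi_isLittleO (hs : 2 ≤ s) (ht : t < s ^ 2 / 4) :
    (fun n => Real.logb 2 (exPi n s (s.choose 2 + t))) =o[atTop] fun n : ℕ => (n : ℝ) ^ 2 := by
  obtain ⟨k, b, hkb, htk⟩ : ∃ k b, s = k + 1 + b ∧ t < (k + 1) * b := by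
    -- The parts are ⌊s/2⌋ and ⌈s/2⌉, with product ⌊s²/4⌋.
    refine ⟨s / 2 - 1, s - s / 2, by omega, ht.trans_le ?_⟩
    rw [Nat.sub_add_cancel (by omega)]
    rcases Nat.even_or_odd' s with ⟨m, rfl | rfl⟩
    · rw [show 2 * m / 2 = m by omega, show 2 * m - m = m by omega]
      exact Nat.div_le_of_le_mul (le_of_eq (by ring))
    · rw [show (2 * m + 1) / 2 = m by omega, show 2 * m + 1 - m = m + 1 by omega,
        Nat.div_le_iff_le_mul_add_pred (by norm_num)]
      exact le_trans (le_of_eq (by ring)) (Nat.add_le_add_left (by norm_num : 1 ≤ 4 - 1) _)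
  have key : ∀ n, s ≤ n → ∃ D : ℕ,
      Real.logb 2 (exPi n s (s.choose 2 + t)) ≤ t * (D + k * n) ∧
      (D : ℝ) ^ (k + 1) ≤ b * (n : ℝ) ^ (2 * k + 1) := by
    intro n hn
    obtain ⟨x, hx, hle⟩ := exists_esum_of_exPi_ne_zero hs hn (exPi_ne_zero (t := t) hs hn)
    obtain ⟨D, hD1, hD2⟩ := kovari_sos_turan (x := x) (k := k) (b := b) (M := t)
      (fun X hX => (hx X (by omega)).trans_lt htk)
      (fun u v huv => apply_le_of_esum_le hs hn hx (by simpa using huv))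
    rw [Fintype.card_fin] at hD1 hD2
    refine ⟨D, (logb_two_le hle (exPi_ne_zero hs hn)).trans ?_, by exact_mod_cast hD2⟩
    exact_mod_cast hD1
  rw [isLittleO_iff]
  intro c hc
  -- Half of c absorbs t·D through D ≤ δn², the other half the linear term t·k·n. The thresholds
  -- `e1` and `e2` serve these two halves.
  obtain ⟨δ, hδ, hδc⟩ : ∃ δ : ℝ, 0 < δ ∧ t * δ ≤ c / 2 := by
    refine ⟨c / 2 / (t + 1), by positivity, ?_⟩
    rw [mul_div_assoc', div_le_iff₀ (by positivity)]
    nlinarith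
  have e1 : ∀ᶠ n : ℕ in atTop, (b : ℝ) / δ ^ (k + 1) < n :=
    tendsto_natCast_atTop_atTop.eventually_gt_atTop _
  have e2 : ∀ᶠ n : ℕ in atTop, (t * k : ℝ) / (c / 2) < n :=
    tendsto_natCast_atTop_atTop.eventually_gt_atTop _
  filter_upwards [e1, e2, eventually_ge_atTop s] with n h1 h2 hn
  obtain ⟨D, hD1, hD2⟩ := key n hn
  rw [Real.norm_of_nonneg logb_exPi_nonneg, Real.norm_of_nonneg (by positivity)]
  have hn0 : (0 : ℝ) < n := by exact_mod_cast (by omega : 0 < n)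
  have hD : (D : ℝ) ≤ δ * n ^ 2 := by
    refine le_of_not_gt fun hlt => ?_
    have h3 := pow_lt_pow_left₀ hlt (by positivity) (Nat.succ_ne_zero k)
    rw [div_lt_iff₀ (by positivity)] at h1
    have h4 : (b : ℝ) * n ^ (2 * k + 1) < (n * δ ^ (k + 1)) * n ^ (2 * k + 1) :=
      mul_lt_mul_of_pos_right h1 (by positivity)
    have h5 : (n * δ ^ (k + 1)) * (n : ℝ) ^ (2 * k + 1) = (δ * n ^ 2) ^ (k + 1) := by ring
    exact absurd (h3.trans_le hD2) (not_lt.2 (h4.le.trans h5.le))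
  rw [div_lt_iff₀ (by positivity)] at h2
  calc Real.logb 2 (exPi n s (s.choose 2 + t)) ≤ t * (D + k * n) := hD1
    _ ≤ t * (δ * n ^ 2 + k * n) := by gcongr
    _ = (t * δ) * n ^ 2 + (t * k) * n := by ring
    _ ≤ c / 2 * n ^ 2 + (n * (c / 2)) * n := by gcongr
    _ = c * n ^ 2 := by ring

end Values

end ProductTuran
theorem mainTheorem4 (s q : ℕ) (hs : 2 ≤ s) (hq : q ≤ 2 * s.choose 2) :
    (q < s.choose 2 → ∀ n : ℕ, s ≤ n → ProductTuran.exPi n s q = 0) ∧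
    (q = s.choose 2 → ∀ n : ℕ, s ≤ n → ProductTuran.exPi n s q = 1) ∧
    (s.choose 2 < q → q < s.choose 2 + s / 2 →
      ∀ n : ℕ, s ≤ n → ProductTuran.exPi n s q = 2 ^ (q - s.choose 2)) ∧
    (s.choose 2 + s / 2 ≤ q → q < s.choose 2 + (s - 2) →
      ∃ f : ℕ → ℝ, f =Θ[atTop] (fun n : ℕ => (n : ℝ)) ∧
        ∀ n : ℕ, s ≤ n → (ProductTuran.exPi n s q : ℝ) = (2 : ℝ) ^ f n) ∧
    (q = s.choose 2 + (s - 2) →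
      ∀ n : ℕ, s ≤ n → ProductTuran.exPi n s q = 2 ^ ((s - 2) * n / (s - 1))) ∧
    (q = s.choose 2 + (s - 1) →
      ∀ n : ℕ, s ≤ n → ProductTuran.exPi n s q = 2 ^ ProductTuran.exCycles n s) ∧
    (s.choose 2 + s ≤ q → q < s.choose 2 + s ^ 2 / 4 →
      ∃ f : ℕ → ℝ, f =o[atTop] (fun n : ℕ => (n : ℝ) ^ 2) ∧
        ∀ n : ℕ, s ≤ n → (ProductTuran.exPi n s q : ℝ) = (2 : ℝ) ^ f n) ∧
    (s.choose 2 + s ^ 2 / 4 ≤ q →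
      ∃ f : ℕ → ℝ, f =Θ[atTop] (fun n : ℕ => (n : ℝ) ^ 2) ∧
        ∀ n : ℕ, s ≤ n → (ProductTuran.exPi n s q : ℝ) = (2 : ℝ) ^ f n) := by

  have hsplit : s.choose 2 ≤ q → ∃ t, q = s.choose 2 + t := fun h => ⟨q - s.choose 2, by omega⟩
  refine ⟨fun h n hn => ProductTuran.exPi_eq_zero hs hn h,
    fun h n hn => h ▸ ProductTuran.exPi_choose_two hs hn, fun h1 h2 n hn => ?_, fun h1 h2 => ?_,
    fun h n hn => h ▸ ProductTuran.exPi_of_eq_sub_two hs hn,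
    fun h n hn => h ▸ ProductTuran.exPi_of_eq_sub_one hs hn, fun h1 h2 => ?_, fun h1 => ?_⟩
  all_goals
    obtain ⟨t, rfl⟩ := hsplit (by omega)
  · rw [Nat.add_sub_cancel_left]
    exact ProductTuran.exPi_of_lt_half hs hn (by omega)
  -- The exponent is the base-2 logarithm of the extremal number itself, so equality is exact for
  -- all n ≥ s.
  · exact ⟨_, ProductTuran.logb_exPi_isTheta_linear hs (by omega) (by omega),
      fun n hn => ProductTuran.rpow_logb_exPi hs hn⟩
  · exact ⟨_, ProductTuran.logb_exPi_isLittleO hs (by omega),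
      fun n hn => ProductTuran.rpow_logb_exPi hs hn⟩
  · exact ⟨_, ProductTuran.logb_exPi_isTheta_quadratic hs (by omega),
      fun n hn => ProductTuran.rpow_logb_exPi hs hn⟩
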